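/- For $n\ge 0$ let $\mathcal S_n^B$ be the set of signed permutations $\sigma=\sigma(1)\cdots\sigma(n)$ of $\{1,\dots,n\}$, with the convention $\sigma(0)=0$. Let $\mathrm{altdes}_B(\sigma)$ be the number of positions $j\in\{0,1,\dots,n-1\}$ such that $\sigma(j)<\sigma(j+1)$ if $j$ is even, and $\sigma(j)>\sigma(j+1)$ if $j$ is odd. Put $$\widehat B_n(x)=\sum_{\sigma\in\mathcal S_n^B}x^{\mathrm{altdes}_B(\sigma)} .$$ For a permutation $\pi\in\mathfrak S_n$ of $\{1,\dots,n\}$, with the convention $\pi(0)=0$, let $\mathrm{lpk}(\pi)=\#\{1\le i\le n-1:\ \pi(i-1)<\pi(i)>\pi(i+1)\}$. Let $Q_n$ be the polynomial determined by $\frac{d^n}{d\theta^n}\sec\theta=\sec\theta\cdot Q_n(\tan\theta)$; equivalently, $Q_0(x)=1$ and $Q_{n+1}(x)=xQ_n(x)+(1+x^2)Q_n'(x)$. Let the integers $\xi_{n,i}$ ($n\ge 0$, $i\in\mathbb Z$) be given by $\xi_{0,0}=1$, $\xi_{0,i}=0$ for $i\ne 0$, and $$\xi_{n+1,i}=(1+2n-6i)\,\xi_{n,i}+(n-2i+2)\,\xi_{n,i-1}-4(i+1)\,\xi_{n,i+1}.$$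 **Theorem.** One has $\xi_{n,i}=0$ unless $0\le i\le\lfloor n/2\rfloor$. For every $n\ge 0$, with $\xi_n(x)=\sum_{i=0}^{\lfloor n/2\rfloor}\xi_{n,i}x^i$, the following hold. 1. $\displaystyle \widehat B_n(x)=\sum_{i=0}^{\lfloor n/2\rfloor}\xi_{n,i}(-4x)^i(1+x)^{n-2i}$. 2. $\displaystyle \xi_n(x-1)=\sum_{\pi\in\mathfrak S_n}(x+1)^{\mathrm{lpk}(\pi)}$ as polynomials, and $\xi_n(x-1)=x^{n/2}\,Q_n\!\left(\frac1{\sqrt x}\right)$ for all real $x>0$. 3. Equivalently, $\displaystyle \xi_n(x-2)=\sum_{\pi\in\mathfrak S_n}x^{\mathrm{lpk}(\pi)}$. 4. $\xi_{n,i}$ is a positive integer for all $0\le i\le\lfloor n/2\rfloor$. 5. The $\gamma$-vector of $\widehat B_n$ alternates in sign: there are unique integers $\gamma_0,\dots,\gamma_{\lfloor n/2\rfloor}$ with $\widehat B_n(x)=\sum_{k=0}^{\lfloor n/2\rfloor}\gamma_kx^k(1+x)^{n-2k}$, namely $\gamma_k=(-4)^k\xi_{n,k}$, and $(-1)^k\gamma_k>0$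 for all $0\le k\le\lfloor n/2\rfloor$. -/

import Mathlib

open Polynomial

/-- A signed permutation of `{1, …, n}` (an element of the hyperoctahedral group), given by
the permutation of the absolute values of its entries and the signs of its entries. -/
abbrev SignedPerm (n : ℕ) : Type := Equiv.Perm (Fin n) × (Fin n → ℤˣ)

/-- One-line notation of a signed permutation: `σ(0) = 0`, and `σ(j) ∈ {±1, …, ±n}` for
`1 ≤ j ≤ n`. The value for `j > n` is a dummy and is never used. -/
def SignedPerm.word {n : ℕ} (σ : SignedPerm n) (j : ℕ) : ℤ :=
  if h : 1 ≤ j ∧ j ≤ n then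
    (σ.2 ⟨j - 1, by omega⟩ : ℤ) * (((σ.1 ⟨j - 1, by omega⟩ : Fin n) : ℕ) + 1 : ℤ)
  else 0

/-- The type `B` alternating descent number: the number of positions `0 ≤ j < n` such that
`σ(j) < σ(j+1)` if `j` is even, and `σ(j) > σ(j+1)` if `j` is odd. -/
def altdesB {n : ℕ} (σ : SignedPerm n) : ℕ :=
  ((Finset.range n).filter fun j =>
    (Even j ∧ σ.word j < σ.word (j + 1)) ∨ (Odd j ∧ σ.word j > σ.word (j + 1))).card

/-- The type `B` alternating Eulerian polynomial. -/
noncomputable def altEulerianB (n : ℕ) : ℤ[X] :=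
  ∑ σ : SignedPerm n, X ^ altdesB σ

/-- One-line notation of a permutation of `{1, …, n}` with the convention `π(0) = 0`.
The value for `j > n` is a dummy and is never used. -/
def permWord {n : ℕ} (π : Equiv.Perm (Fin n)) (j : ℕ) : ℕ :=
  if h : 1 ≤ j ∧ j ≤ n then ((π ⟨j - 1, by omega⟩ : Fin n) : ℕ) + 1 else 0

/-- The number of left peaks: the indices `1 ≤ i ≤ n - 1` with `π(i-1) < π(i) > π(i+1)`. -/
def lpk {n : ℕ} (π : Equiv.Perm (Fin n)) : ℕ :=
  ((Finset.Icc 1 (n - 1)).filter fun i =>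
    permWord π (i - 1) < permWord π i ∧ permWord π i > permWord π (i + 1)).card

/-- The derivative polynomials `Q_n` for the secant. See `secDerivPoly_unique` for the
defining property in terms of the derivatives of `sec`. -/
noncomputable def secDerivPoly : ℕ → ℤ[X]
  | 0 => 1
  | n + 1 => X * secDerivPoly n + (1 + X ^ 2) * derivative (secDerivPoly n)

/-- The `n`-th derivative of `sec` at `θ` is `sec θ * Q_n (tan θ)`. -/
theorem iteratedDeriv_sec (n : ℕ) (θ : ℝ) (hθ : Real.cos θ ≠ 0) :
    iteratedDeriv n (fun t : ℝ => 1 / Real.cos t) θ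
      = 1 / Real.cos θ * aeval (Real.tan θ) (secDerivPoly n) := by
  induction n generalizing θ with
  | zero => simp [secDerivPoly]
  | succ n ih =>
    rw [iteratedDeriv_succ]
    have hev : iteratedDeriv n (fun t : ℝ => 1 / Real.cos t) =ᶠ[nhds θ]
        fun t => 1 / Real.cos t * aeval (Real.tan t) (secDerivPoly n) := by
      filter_upwards [Real.continuous_cos.continuousAt.eventually_ne hθ] with t ht
      exact ih t ht
    rw [hev.deriv_eq]
    have h1 : HasDerivAt (fun t : ℝ => 1 / Real.cos t)
        (Real.sin θ / Real.cos θ ^ 2) θ := by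
      have := (Real.hasDerivAt_cos θ).fun_inv hθ
      simpa [one_div] using this
    have h2 := (Polynomial.hasDerivAt_aeval (secDerivPoly n) (Real.tan θ)).comp θ
      (Real.hasDerivAt_tan hθ)
    have h3 := (h1.mul h2).deriv
    refine Eq.trans h3 ?_
    have ht : 1 / Real.cos θ ^ 2 = 1 + Real.tan θ ^ 2 := by
      rw [Real.tan_eq_sin_div_cos]
      field_simp
      linarith [Real.sin_sq_add_cos_sq θ]
    have hs : Real.sin θ / Real.cos θ ^ 2 = 1 / Real.cos θ * Real.tan θ := by
      rw [Real.tan_eq_sin_div_cos]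
      field_simp
    rw [ht, hs]
    simp [secDerivPoly]
    ring

/-- `Q_n` is the only real polynomial with `(d/dθ)^n sec θ = sec θ * Q_n (tan θ)`. -/
theorem secDerivPoly_unique (n : ℕ) (P : ℝ[X]) :
    (∀ θ : ℝ, Real.cos θ ≠ 0 → iteratedDeriv n (fun t : ℝ => 1 / Real.cos t) θ
      = 1 / Real.cos θ * P.eval (Real.tan θ))
    ↔ P = (secDerivPoly n).map (Int.castRingHom ℝ) := by
  have key : ∀ x : ℝ, ((secDerivPoly n).map (Int.castRingHom ℝ)).eval x
      = aeval x (secDerivPoly n) := fun x => by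
    rw [Polynomial.eval_map, Polynomial.aeval_def]; rfl
  constructor
  · intro h
    apply Polynomial.funext
    intro x
    have hc : Real.cos (Real.arctan x) ≠ 0 := (Real.cos_arctan_pos x).ne'
    have h1 := h (Real.arctan x) hc
    rw [iteratedDeriv_sec n _ hc, Real.tan_arctan] at h1
    rw [key]
    exact (mul_left_cancel₀ (one_div_ne_zero hc) h1).symm
  · rintro rfl θ hθ
    rw [key]
    exact iteratedDeriv_sec n θ hθ

/-- The numbers `ξ_{n,i}` (`n ∈ ℕ`, `i ∈ ℤ`), given by their recurrence. -/
def xi : ℕ → ℤ → ℤ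
  | 0, i => if i = 0 then 1 else 0
  | n + 1, i => (1 + 2 * (n : ℤ) - 6 * i) * xi n i + ((n : ℤ) - 2 * i + 2) * xi n (i - 1)
      - 4 * (i + 1) * xi n (i + 1)

/-- `ξ_n(x) = ∑_{0 ≤ i ≤ ⌊n/2⌋} ξ_{n,i} x^i`. -/
noncomputable def xiPoly (n : ℕ) : ℤ[X] :=
  ∑ i ∈ Finset.range (n / 2 + 1), C (xi n i) * X ^ i

/-- `γ_0, …, γ_{⌊n/2⌋}` is the `γ`-vector of `f` (regarded as a polynomial of degree at most
`n`): `f(x) = ∑_{0 ≤ k ≤ ⌊n/2⌋} γ_k x^k (1+x)^{n-2k}`. The values `γ_k` for `k > ⌊n/2⌋` are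
irrelevant. -/
def IsGammaVector (n : ℕ) (f : ℤ[X]) (γ : ℕ → ℤ) : Prop :=
  f = ∑ k ∈ Finset.range (n / 2 + 1), C (γ k) * X ^ k * (1 + X) ^ (n - 2 * k)

/-!
The theorem rests on the left peak polynomials `L_n = ∑_π X ^ lpk π`, through the identity
`ξ_n(x) = L_n(x + 2)` (`xiPoly_eq_comp`).

That identity holds because both sides satisfy the same recurrence. For `L_n` it is obtained by
inserting a new maximum into a permutation of `n` letters with `k` left peaks: of the `n + 1`
slots, the last one and the `2k` slots adjacent to a left peak preserve the number of left peaks,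
and the others increase it by one (`lpk_insertMax`, `lpkPoly_succ`). The formulas for `ξ_n(x - 1)`
and `ξ_n(x - 2)` follow by substitution. Expanding `(x + 2) ^ lpk π` writes `ξ_{n,i}` as a sum of
nonnegative terms, in which a permutation with exactly `i` left peaks contributes a positive
one; this gives positivity (`xi_pos`).

For the alternating Eulerian polynomial, the permutation `π` of absolute values is fixed and the
signs are summed. Each comparison of adjacent entries is decided by the sign of the entry with
the larger absolute value, so every entry decides zero, one or two comparisons: two at a peak,
none at a valley, one elsewhere. For the alternating statistic, both comparisons decided by an
entry count or neither does. Hence the sum over the signs is a product of factors `1 + X ^ 2`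
(peaks), `2` (valleys) and `1 + X` (other entries). With a final descent counted as a valley
there are as many valleys as peaks, and the sum is
`(1 + X) ^ (n - 2k) * (2 * (1 + X ^ 2)) ^ k` with `k = lpk π` (`sum_signs_X_pow_altdesB`).
Since `2 * (1 + X ^ 2) = -4 * X + 2 * (1 + X) ^ 2`, summing over `π` yields
`(1 + X) ^ n * L_n(2 - 4 * X / (1 + X) ^ 2)`, which is the stated expansion
(`altEulerianB_eq_sum_xi`). It is the expansion in the `γ`-basis, and that basis is triangular
with respect to the monomials, so the `γ`-vector is unique.

The secant polynomials are matched by induction: `Q_n(y) = y ^ n * ξ_n(y⁻² - 1)` turns the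
recurrence of `Q_n` into that of `ξ_n` (`aeval_secDerivPoly`).
-/

/-! ### Summation over the signs of a signed permutation -/

theorem word_zero {n : ℕ} (σ : SignedPerm n) : σ.word 0 = 0 := by
  simp [SignedPerm.word]

theorem permWord_zero {n : ℕ} (π : Equiv.Perm (Fin n)) : permWord π 0 = 0 := by
  simp [permWord]

theorem permWord_succ {n : ℕ} (π : Equiv.Perm (Fin n)) {j : ℕ} (hj : j < n) :
    permWord π (j + 1) = (π ⟨j, hj⟩ : ℕ) + 1 := by
  have h : 1 ≤ j + 1 ∧ j + 1 ≤ n := by omega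
  simp [permWord, h]

theorem word_succ {n : ℕ} (σ : SignedPerm n) {j : ℕ} (hj : j < n) :
    σ.word (j + 1) = σ.2 ⟨j, hj⟩ * (permWord σ.1 (j + 1) : ℤ) := by
  have h : 1 ≤ j + 1 ∧ j + 1 ≤ n := by omega
  rw [permWord_succ _ hj]
  simp [SignedPerm.word, h]

theorem permWord_le {n : ℕ} (π : Equiv.Perm (Fin n)) (j : ℕ) : permWord π j ≤ n := by
  unfold permWord
  split_ifs with h
  · exact (π _).isLt
  · exact Nat.zero_le _

theorem permWord_ne_succ {n : ℕ} (π : Equiv.Perm (Fin n)) {j : ℕ} (hj : j < n) :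
    permWord π j ≠ permWord π (j + 1) := by
  rw [permWord_succ _ hj]
  cases j with
  | zero => simp [permWord_zero]
  | succ k =>
    rw [permWord_succ _ (by omega : k < n)]
    intro h
    have := π.injective (Fin.ext (Nat.succ_injective h))
    simp at this

/-- `j` is an ascent of `π`. The position `n` and all later ones count as ascents, which amounts
to the convention `π(n+1) = ∞`. -/
def IsAscent {n : ℕ} (π : Equiv.Perm (Fin n)) (j : ℕ) : Prop :=
  n ≤ j ∨ permWord π j < permWord π (j + 1)

theorem isAscent_zero {n : ℕ} (π : Equiv.Perm (Fin n)) : IsAscent π 0 := by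
  rcases Nat.eq_zero_or_pos n with h | h
  · exact Or.inl h.le
  · right
    rw [permWord_zero, permWord_succ _ h]
    omega

theorem not_isAscent_iff {n : ℕ} (π : Equiv.Perm (Fin n)) {j : ℕ} :
    ¬ IsAscent π j ↔ j < n ∧ permWord π (j + 1) < permWord π j := by
  unfold IsAscent
  constructor
  · intro h
    push Not at h
    exact ⟨h.1, lt_of_le_of_ne h.2 (permWord_ne_succ π h.1).symm⟩
  · rintro ⟨h1, h2⟩
    omega

open Classical in
/-- A left peak is an ascent followed by a descent. -/
theorem lpk_eq_card_ascent_descent {n : ℕ} (π : Equiv.Perm (Fin n)) :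
    lpk π = ((Finset.range n).filter fun j => IsAscent π j ∧ ¬ IsAscent π (j + 1)).card := by
  unfold lpk
  symm
  apply Finset.card_bij (fun j _ => j + 1)
  · intro j hj
    simp only [Finset.mem_filter, Finset.mem_range, not_isAscent_iff, Finset.mem_Icc] at hj ⊢
    obtain ⟨h1, h2, h3, h4⟩ := hj
    exact ⟨by omega, h2.resolve_left (by omega), h4⟩
  · intro a _ b _ h
    omega
  · intro i hi
    simp only [Finset.mem_filter, Finset.mem_Icc] at hi
    obtain ⟨h1, h2, h3⟩ := hi
    refine ⟨i - 1, ?_, by omega⟩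
    simp only [Finset.mem_filter, Finset.mem_range, not_isAscent_iff]
    rw [Nat.sub_add_cancel h1.1]
    refine ⟨by omega, Or.inr ?_, by omega, h3⟩
    rwa [Nat.sub_add_cancel h1.1]

/-- The larger of two absolute values decides a comparison of signed numbers. -/
theorem units_mul_lt_units_mul_iff_right {a b : ℕ} (h : a < b) (u v : ℤˣ) :
    (u : ℤ) * a < v * b ↔ v = 1 := by
  rcases Int.units_eq_one_or u with rfl | rfl <;> rcases Int.units_eq_one_or v with rfl | rfl <;>
    simp <;> omega

open Classical in
/-- The weight contributed by the sign at position `j + 1` to every comparison that it decides: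
`X` if the sign is positive exactly when `j` is even, and `1` otherwise. The value `1` for `j ≥ n`
is a dummy. -/
noncomputable def signWeight {n : ℕ} (ε : Fin n → ℤˣ) (j : ℕ) : ℤ[X] :=
  if h : j < n then (if Even j ↔ ε ⟨j, h⟩ = 1 then X else 1) else 1

open Classical in
/-- The comparison of `σ(j)` and `σ(j+1)` is decided by the sign of the entry with the larger
absolute value: the right one at an ascent of `|σ|`, the left one at a descent. -/
theorem X_pow_altdesB {n : ℕ} (π : Equiv.Perm (Fin n)) (ε : Fin n → ℤˣ) :
    (X : ℤ[X]) ^ altdesB ((π, ε) : SignedPerm n) =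
      ∏ j ∈ Finset.range n, if IsAscent π j then signWeight ε j else signWeight ε (j - 1) := by
  unfold altdesB
  rw [← Finset.prod_const, Finset.prod_filter]
  refine Finset.prod_congr rfl fun j hj => ?_
  have hj : j < n := Finset.mem_range.1 hj
  have hn := permWord_ne_succ π hj
  have hr := word_succ ((π, ε) : SignedPerm n) hj
  obtain ⟨u, hl⟩ : ∃ u : ℤˣ, SignedPerm.word (π, ε) j = u * (permWord π j : ℤ) := by
    cases j with
    | zero => exact ⟨1, by rw [word_zero, permWord_zero]; simp⟩
    | succ k => exact ⟨_, word_succ ((π, ε) : SignedPerm n) (by omega)⟩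
  by_cases ha : IsAscent π j
  · have hlt : permWord π j < permWord π (j + 1) := ha.resolve_left (by omega)
    have key := units_mul_lt_units_mul_iff_right hlt u (ε ⟨j, hj⟩)
    have hne : SignedPerm.word (π, ε) j ≠ SignedPerm.word (π, ε) (j + 1) := by
      rw [hl, hr]
      intro h
      have := congrArg Int.natAbs h
      simp [Int.natAbs_mul] at this
      omega
    rw [if_pos ha, signWeight, dif_pos hj]
    refine if_congr ?_ rfl rfl
    rw [← hl, ← hr] at key
    rw [← key, ← Nat.not_even_iff_odd]
    by_cases he : Even j
    · simp [he]
    · simp only [he, false_and, not_false_iff, true_and, false_or, false_iff]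
      omega
  · have hgt := ((not_isAscent_iff π).1 ha).2
    rw [if_neg ha]
    cases j with
    | zero => exact absurd (isAscent_zero π) ha
    | succ k =>
      have hl := word_succ ((π, ε) : SignedPerm n) (by omega : k < n)
      have key := units_mul_lt_units_mul_iff_right hgt (ε ⟨k + 1, hj⟩) (ε ⟨k, by omega⟩)
      have hne : SignedPerm.word (π, ε) (k + 1) ≠ SignedPerm.word (π, ε) (k + 1 + 1) := by
        rw [hl, hr]
        intro h
        have := congrArg Int.natAbs h
        simp [Int.natAbs_mul] at this
        omega
      rw [Nat.add_sub_cancel, signWeight, dif_pos (by omega : k < n)]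
      refine if_congr ?_ rfl rfl
      rw [← hl, ← hr] at key
      rw [← key, ← Nat.not_even_iff_odd, Nat.even_add_one]
      by_cases he : Even k
      · simp [he]
      · simp only [he, not_false_iff, true_and, not_true, false_and, or_false, false_iff]
        omega

open Classical in
/-- The number of comparisons decided by position `j + 1`, for an arbitrary ascent pattern `a`. -/
noncomputable def ownedEdges (a : ℕ → Prop) (j : ℕ) : ℕ :=
  (if a j then 1 else 0) + (if a (j + 1) then 0 else 1)

open Classical in
/-- Regrouping a product over the edges `(j, j + 1)` by the vertices that own them. The extra
factor accounts for the edge `(m, m + 1)`, which lies outside the product on the right. -/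
theorem prod_pow_ownedEdges {R : Type*} [CommMonoid R] (a : ℕ → Prop) (h0 : a 0) (y : ℕ → R)
    (m : ℕ) :
    ∏ j ∈ Finset.range m, y j ^ ownedEdges a j =
      (∏ j ∈ Finset.range m, if a j then y j else y (j - 1)) *
        if a m then 1 else y (m - 1) := by
  induction m with
  | zero => simp [h0]
  | succ m ih =>
    rw [Finset.prod_range_succ, ih, Finset.prod_range_succ, ownedEdges, pow_add]
    by_cases h1 : a m <;> by_cases h2 : a (m + 1) <;> simp [h1, h2, mul_assoc]

open Classical in
/-- Vertices owning two edges (peaks) and no edge (valleys) alternate along the pattern. Hence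
the product of the `1 + x ^ e_j`, where `e_j` is the number of edges owned by `j`, depends only on
the number of peaks. The first alternative describes patterns ending after a valley, the
second those in which the last peak is not yet followed by a valley. -/
theorem prod_one_add_pow_ownedEdges {R : Type*} [CommSemiring R] (a : ℕ → Prop) (h0 : a 0)
    (x : R) (m : ℕ) :
    let T := ((Finset.range m).filter fun j => a j ∧ ¬ a (j + 1)).card
    let P := ∏ j ∈ Finset.range m, (1 + x ^ ownedEdges a j)
    (a m → 2 * T ≤ m ∧ P = (1 + x) ^ (m - 2 * T) * (2 * (1 + x ^ 2)) ^ T) ∧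
    (¬ a m → 2 * T ≤ m + 1 ∧ P * 2 = (1 + x) ^ (m + 1 - 2 * T) * (2 * (1 + x ^ 2)) ^ T) := by
  induction m with
  | zero => simp [h0]
  | succ m ih =>
    simp only [Finset.prod_range_succ] at ih ⊢
    simp only [Finset.range_add_one, Finset.filter_insert] at ih ⊢
    set T := ((Finset.range m).filter fun j => a j ∧ ¬ a (j + 1)).card with hT
    by_cases h1 : a m <;> by_cases h2 : a (m + 1) <;>
      simp only [h1, h2, ownedEdges, not_true, not_false_iff, true_imp_iff, false_imp_iff,
        true_and, and_true, if_true, if_false, and_false] at ih ⊢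
    · obtain ⟨hle, e⟩ := ih
      rw [← hT]
      refine ⟨by omega, ?_⟩
      rw [e, show m + 1 - 2 * T = m - 2 * T + 1 by omega]
      ring
    · obtain ⟨hle, e⟩ := ih
      rw [Finset.card_insert_of_notMem (by simp), ← hT]
      refine ⟨by omega, ?_⟩
      rw [e, show m + 1 + 1 - 2 * (T + 1) = m - 2 * T by omega]
      ring
    · obtain ⟨hle, e⟩ := ih
      rw [← hT]
      refine ⟨hle, ?_⟩
      rw [← e]
      ring
    · obtain ⟨hle, e⟩ := ih
      rw [← hT]
      refine ⟨by omega, ?_⟩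
      rw [show m + 1 + 1 - 2 * T = m + 1 - 2 * T + 1 by omega, mul_right_comm, e]
      ring

theorem two_mul_lpk_le {n : ℕ} (π : Equiv.Perm (Fin n)) : 2 * lpk π ≤ n := by
  classical
  have := ((prod_one_add_pow_ownedEdges (IsAscent π) (isAscent_zero π) (1 : ℕ) n).1
    (Or.inl le_rfl)).1
  rwa [← lpk_eq_card_ascent_descent] at this

/-- The signs are summed independently: a peak contributes `1 + X ^ 2`, a valley (the last
position included, if it is a descent) `2`, every other position `1 + X`. -/
theorem sum_signs_X_pow_altdesB {n : ℕ} (π : Equiv.Perm (Fin n)) :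
    ∑ ε : Fin n → ℤˣ, (X : ℤ[X]) ^ altdesB ((π, ε) : SignedPerm n) =
      (1 + X) ^ (n - 2 * lpk π) * (2 * (1 + X ^ 2)) ^ lpk π := by
  classical
  have hlast : IsAscent π n := Or.inl le_rfl
  have h := ((prod_one_add_pow_ownedEdges (IsAscent π) (isAscent_zero π) (X : ℤ[X]) n).1 hlast).2
  rw [lpk_eq_card_ascent_descent, ← h]
  calc ∑ ε : Fin n → ℤˣ, (X : ℤ[X]) ^ altdesB ((π, ε) : SignedPerm n)
      = ∑ ε : Fin n → ℤˣ, ∏ i : Fin n,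
          (if Even (i : ℕ) ↔ ε i = 1 then (X : ℤ[X]) else 1) ^ ownedEdges (IsAscent π) i := by
        refine Finset.sum_congr rfl fun ε _ => ?_
        have := prod_pow_ownedEdges (IsAscent π) (isAscent_zero π) (signWeight ε) n
        rw [if_pos hlast, mul_one] at this
        rw [X_pow_altdesB, ← this, ← Fin.prod_univ_eq_prod_range
          (fun j => signWeight ε j ^ ownedEdges (IsAscent π) j)]
        simp [signWeight]
    _ = ∏ i : Fin n, ∑ u : ℤˣ,
          (if Even (i : ℕ) ↔ u = 1 then (X : ℤ[X]) else 1) ^ ownedEdges (IsAscent π) i := by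
        rw [Finset.prod_univ_sum, Fintype.piFinset_univ]
    _ = ∏ j ∈ Finset.range n, (1 + X ^ ownedEdges (IsAscent π) j) := by
        rw [← Fin.prod_univ_eq_prod_range (fun j => 1 + (X : ℤ[X]) ^ ownedEdges (IsAscent π) j)]
        refine Finset.prod_congr rfl fun i _ => ?_
        have hu : (Finset.univ : Finset ℤˣ) = {1, -1} := rfl
        have hne : (-1 : ℤˣ) ≠ 1 := by decide
        rw [hu, Finset.sum_pair hne.symm]
        by_cases he : Even (i : ℕ) <;> simp [he, hne, add_comm]

theorem altEulerianB_eq_sum_perm (n : ℕ) :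
    altEulerianB n = ∑ π : Equiv.Perm (Fin n),
      (1 + X) ^ (n - 2 * lpk π) * (2 * (1 + X ^ 2)) ^ lpk π := by
  unfold altEulerianB
  rw [Fintype.sum_prod_type]
  exact Finset.sum_congr rfl fun π _ => sum_signs_X_pow_altdesB π

/-! ### Left peak polynomials -/

/-- The generating polynomial of the left peak number on the symmetric group. -/
noncomputable def lpkPoly (n : ℕ) : ℤ[X] := ∑ π : Equiv.Perm (Fin n), X ^ lpk π

/-- The permutation of `n + 1` letters obtained from `π` by inserting a new maximum at
position `p`. -/
def insertMax {n : ℕ} (p : Fin (n + 1)) (π : Equiv.Perm (Fin n)) : Equiv.Perm (Fin (n + 1)) :=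
  ((finSuccEquiv' p).trans (Equiv.optionCongr π)).trans (finSuccEquiv' (Fin.last n)).symm

theorem insertMax_self {n : ℕ} (p : Fin (n + 1)) (π : Equiv.Perm (Fin n)) :
    insertMax p π p = Fin.last n := by
  simp [insertMax]

theorem insertMax_succAbove {n : ℕ} (p : Fin (n + 1)) (π : Equiv.Perm (Fin n)) (i : Fin n) :
    insertMax p π (p.succAbove i) = (π i).castSucc := by
  simp [insertMax]

theorem insertMax_bijective (n : ℕ) :
    Function.Bijective fun q : Fin (n + 1) × Equiv.Perm (Fin n) => insertMax q.1 q.2 := by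
  rw [Fintype.bijective_iff_injective_and_card]
  constructor
  · rintro ⟨p, π⟩ ⟨p', π'⟩ h
    simp only at h
    have hp : p = p' := (insertMax p' π').injective <| by
      rw [insertMax_self, ← h, insertMax_self]
    subst hp
    congr 1
    ext1 i
    have := congrArg (fun f => f (p.succAbove i)) h
    simpa [insertMax_succAbove] using this
  · simp [Fintype.card_perm, Nat.factorial_succ]

theorem permWord_insertMax_of_le {n : ℕ} (p : Fin (n + 1)) (π : Equiv.Perm (Fin n)) {j : ℕ}
    (h : j ≤ p) : permWord (insertMax p π) j = permWord π j := by
  cases j with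
  | zero => simp [permWord_zero]
  | succ i =>
    have hi : i < n := by omega
    rw [permWord_succ _ hi, permWord_succ _ (by omega : i < n + 1)]
    have : (⟨i, by omega⟩ : Fin (n + 1)) = p.succAbove ⟨i, hi⟩ := by
      rw [Fin.succAbove_of_castSucc_lt _ _ (by rw [Fin.lt_def]; exact h)]
      rfl
    rw [this, insertMax_succAbove]
    rfl

theorem permWord_insertMax_self {n : ℕ} (p : Fin (n + 1)) (π : Equiv.Perm (Fin n)) :
    permWord (insertMax p π) (p + 1) = n + 1 := by
  rw [permWord_succ _ p.isLt, Fin.eta, insertMax_self]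
  rfl

theorem permWord_insertMax_of_lt {n : ℕ} (p : Fin (n + 1)) (π : Equiv.Perm (Fin n)) {j : ℕ}
    (h : p < j) (hj : j ≤ n) : permWord (insertMax p π) (j + 1) = permWord π j := by
  obtain ⟨i, rfl⟩ : ∃ i, j = i + 1 := ⟨j - 1, by omega⟩
  have hi : i < n := by omega
  rw [permWord_succ _ hi, permWord_succ _ (by omega : i + 1 < n + 1)]
  have : (⟨i + 1, by omega⟩ : Fin (n + 1)) = p.succAbove ⟨i, hi⟩ := by
    rw [Fin.succAbove_of_le_castSucc _ _ (by rw [Fin.le_def]; simp; omega)]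
    rfl
  rw [this, insertMax_succAbove]
  rfl

/-- `i` is a left peak of `π`. -/
def IsLeftPeak {n : ℕ} (π : Equiv.Perm (Fin n)) (i : ℕ) : Prop :=
  1 ≤ i ∧ i + 1 ≤ n ∧ permWord π (i - 1) < permWord π i ∧ permWord π (i + 1) < permWord π i

open Classical in
theorem lpk_eq_sum {n m : ℕ} (π : Equiv.Perm (Fin n)) (hm : n ≤ m) :
    lpk π = ∑ i ∈ Finset.range m, if IsLeftPeak π i then 1 else 0 := by
  rw [← Finset.card_filter]
  unfold lpk
  congr 1
  ext i
  rw [Finset.mem_filter, Finset.mem_Icc, Finset.mem_filter, Finset.mem_range]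
  constructor
  · rintro ⟨⟨h1, h2⟩, h3, h4⟩
    exact ⟨by omega, h1, by omega, h3, h4⟩
  · rintro ⟨_, h1, h2, h3, h4⟩
    exact ⟨⟨h1, by omega⟩, h3, h4⟩

theorem not_isLeftPeak_zero {n : ℕ} (π : Equiv.Perm (Fin n)) : ¬ IsLeftPeak π 0 :=
  fun h => absurd h.1 (by omega)

theorem IsLeftPeak.not_succ {n : ℕ} {π : Equiv.Perm (Fin n)} {i : ℕ} (h : IsLeftPeak π i) :
    ¬ IsLeftPeak π (i + 1) := by
  intro h'
  have h1 := h.2.2.2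
  have h2 := h'.2.2.1
  rw [Nat.add_sub_cancel] at h2
  omega

open Classical in
/-- Appending the maximum keeps all left peaks; inserting it before position `p + 1 ≤ n` creates
a left peak and destroys those at `p` and `p + 1`. -/
theorem lpk_insertMax {n : ℕ} (p : Fin (n + 1)) (π : Equiv.Perm (Fin n)) :
    lpk (insertMax p π) + ((if IsLeftPeak π p then 1 else 0) +
      (if IsLeftPeak π (p + 1) then 1 else 0)) = lpk π + if (p : ℕ) < n then 1 else 0 := by
  obtain ⟨q, hq⟩ : ∃ q, n = p + q := ⟨n - p, by omega⟩
  set π' := insertMax p π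
  have hself : permWord π' (p + 1) = n + 1 := permWord_insertMax_self p π
  have hlow : ∀ i, i < (p : ℕ) → (IsLeftPeak π' i ↔ IsLeftPeak π i) := by
    intro i hi
    unfold IsLeftPeak
    rw [permWord_insertMax_of_le p π (by omega : i - 1 ≤ p),
      permWord_insertMax_of_le p π (by omega : i ≤ p),
      permWord_insertMax_of_le p π (by omega : i + 1 ≤ p)]
    constructor <;> rintro ⟨h1, h2, h3⟩ <;> exact ⟨h1, by omega, h3⟩
  have hp : ¬ IsLeftPeak π' p := by
    rintro ⟨_, _, _, h⟩
    rw [hself] at h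
    have := permWord_le π' p
    omega
  rw [lpk_eq_sum π' (by omega : n + 1 ≤ p + 1 + (q + 1)),
    lpk_eq_sum π (by omega : n ≤ p + 1 + q), Finset.sum_range_add _ _ (q + 1),
    Finset.sum_range_add _ _ q, Finset.sum_range_succ _ (p : ℕ), Finset.sum_range_succ _ (p : ℕ),
    if_neg hp, Finset.sum_congr rfl fun i hi => if_congr (hlow i (Finset.mem_range.1 hi)) rfl rfl]
  cases q with
  | zero =>
    have h1 : ¬ IsLeftPeak π p := fun h => by have := h.2.1; omega
    have h2 : ¬ IsLeftPeak π (p + 1) := fun h => by have := h.2.1; omega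
    have h3 : ¬ IsLeftPeak π' (p + 1) := fun h => by have := h.2.1; omega
    have h4 : ¬ (p : ℕ) < n := by omega
    simp only [Finset.sum_range_succ, Finset.sum_range_zero, add_zero, if_neg h1, if_neg h2,
      if_neg h3, if_neg h4]
  | succ r =>
    have hpn : (p : ℕ) < n := by omega
    have h1 : IsLeftPeak π' (p + 1) := by
      refine ⟨by omega, by omega, ?_, ?_⟩
      · rw [hself, Nat.add_sub_cancel, permWord_insertMax_of_le p π le_rfl]
        exact Nat.lt_succ_of_le (permWord_le _ _)
      · rw [hself, permWord_insertMax_of_lt p π (by omega) (by omega : (p : ℕ) + 1 ≤ n)]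
        exact Nat.lt_succ_of_le (permWord_le _ _)
    have h2 : ¬ IsLeftPeak π' (p + 1 + 1) := by
      rintro ⟨_, _, h, _⟩
      rw [Nat.add_sub_cancel, hself] at h
      have := permWord_le π' (p + 1 + 1)
      omega
    have hhigh : ∀ i, (IsLeftPeak π' (p + 1 + (i + 1 + 1)) ↔ IsLeftPeak π (p + 1 + (i + 1))) := by
      intro i
      by_cases hi : (p : ℕ) + 1 + (i + 1) + 1 ≤ n
      · unfold IsLeftPeak
        rw [show (p : ℕ) + 1 + (i + 1 + 1) - 1 = (p + 1 + i) + 1 by omega,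
          show (p : ℕ) + 1 + (i + 1 + 1) + 1 = (p + 1 + (i + 1) + 1) + 1 by omega,
          show (p : ℕ) + 1 + (i + 1 + 1) = (p + 1 + (i + 1)) + 1 by omega,
          permWord_insertMax_of_lt p π (by omega) (by omega : (p : ℕ) + 1 + i ≤ n),
          permWord_insertMax_of_lt p π (by omega) (by omega : (p : ℕ) + 1 + (i + 1) ≤ n),
          permWord_insertMax_of_lt p π (by omega) hi,
          show (p : ℕ) + 1 + (i + 1) - 1 = p + 1 + i by omega]
        constructor <;> rintro ⟨_, _, h3⟩ <;> exact ⟨by omega, by omega, h3⟩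
      · constructor <;> intro h <;> have := h.2.1 <;> omega
    rw [Finset.sum_range_succ', Finset.sum_range_succ', Finset.sum_range_succ' _ r]
    simp only [hhigh, add_zero, zero_add, if_pos h1, if_neg h2, if_pos hpn]
    omega

open Classical in
theorem card_slots_adjacent_to_leftPeak {n : ℕ} (π : Equiv.Perm (Fin n)) :
    ∑ p ∈ Finset.range n, ((if IsLeftPeak π p then 1 else 0) +
      (if IsLeftPeak π (p + 1) then 1 else 0)) = 2 * lpk π := by
  have h2 : ∑ p ∈ Finset.range n, (if IsLeftPeak π (p + 1) then 1 else 0) = lpk π := by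
    rw [lpk_eq_sum π n.le_succ, Finset.sum_range_succ', if_neg (not_isLeftPeak_zero π), add_zero]
  rw [Finset.sum_add_distrib, h2, ← lpk_eq_sum π le_rfl]
  ring

/-- Of the `n + 1` positions for a new maximum, `1 + 2 lpk π` preserve the left peak number
and `n - 2 lpk π` increase it by one. -/
theorem sum_X_pow_lpk_insertMax {n : ℕ} (π : Equiv.Perm (Fin n)) :
    ∑ p : Fin (n + 1), (X : ℤ[X]) ^ lpk (insertMax p π) =
      (1 + 2 * (lpk π : ℤ[X])) * X ^ lpk π + ((n : ℤ[X]) - 2 * (lpk π : ℤ[X])) * X ^ (lpk π + 1) := by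
  classical
  let e : ℕ → ℕ := fun p => (if IsLeftPeak π p then 1 else 0) +
      (if IsLeftPeak π (p + 1) then 1 else 0)
  have hlast : lpk (insertMax (Fin.last n) π) = lpk π := by
    have h := lpk_insertMax (Fin.last n) π
    have h1 : ¬ IsLeftPeak π n := fun h => by have := h.2.1; omega
    have h2 : ¬ IsLeftPeak π (n + 1) := fun h => by have := h.2.1; omega
    simpa [h1, h2] using h
  have hcast : ∀ p : Fin n, (X : ℤ[X]) ^ lpk (insertMax p.castSucc π) =
      X ^ (lpk π + 1) + (e p : ℤ[X]) * (X ^ lpk π - X ^ (lpk π + 1)) := by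
    intro p
    have h := lpk_insertMax p.castSucc π
    simp only [Fin.val_castSucc, p.isLt, if_true] at h
    have he : e p = 0 ∨ e p = 1 := by
      simp only [e]
      by_cases h1 : IsLeftPeak π p
      · simp [h1, h1.not_succ]
      · by_cases h2 : IsLeftPeak π (p + 1) <;> simp [h1, h2]
    change lpk (insertMax p.castSucc π) + e p = lpk π + 1 at h
    rcases he with he | he
    · rw [show lpk (insertMax p.castSucc π) = lpk π + 1 by omega, he]
      simp
    · rw [show lpk (insertMax p.castSucc π) = lpk π by omega, he]
      simp
  have hsum : ∑ p : Fin n, (e p : ℤ[X]) = 2 * (lpk π : ℤ[X]) := by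
    rw [Fin.sum_univ_eq_sum_range (fun p => (e p : ℤ[X])) n]
    exact_mod_cast congrArg (Nat.cast : ℕ → ℤ[X]) (card_slots_adjacent_to_leftPeak π)
  rw [Fin.sum_univ_castSucc, hlast, Finset.sum_congr rfl fun p _ => hcast p,
    Finset.sum_add_distrib, ← Finset.sum_mul, hsum]
  simp
  ring

theorem lpkPoly_zero : lpkPoly 0 = 1 := by
  simp [lpkPoly, lpk]

theorem lpkPoly_succ (n : ℕ) :
    lpkPoly (n + 1) =
      (1 + (n : ℤ[X]) * X) * lpkPoly n + 2 * X * (1 - X) * derivative (lpkPoly n) := by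
  have hX : ∀ k : ℕ, (X : ℤ[X]) * derivative (X ^ k) = (k : ℤ[X]) * X ^ k := by
    intro k
    cases k with
    | zero => simp
    | succ k => simp; ring
  have hder : (X : ℤ[X]) * derivative (lpkPoly n) =
      ∑ π : Equiv.Perm (Fin n), (lpk π : ℤ[X]) * X ^ lpk π := by
    simp only [lpkPoly, derivative_sum, Finset.mul_sum, hX]
  have h : lpkPoly (n + 1) = ∑ π : Equiv.Perm (Fin n), ((1 + 2 * (lpk π : ℤ[X])) * X ^ lpk π +
      ((n : ℤ[X]) - 2 * (lpk π : ℤ[X])) * X ^ (lpk π + 1)) := by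
    rw [lpkPoly, ← (insertMax_bijective n).sum_comp, Fintype.sum_prod_type_right]
    exact Finset.sum_congr rfl fun π _ => sum_X_pow_lpk_insertMax π
  rw [h, show 2 * X * (1 - X) * derivative (lpkPoly n) =
    2 * (1 - X) * (X * derivative (lpkPoly n)) by ring, hder, lpkPoly, Finset.mul_sum,
    Finset.mul_sum, ← Finset.sum_add_distrib]
  exact Finset.sum_congr rfl fun π _ => by ring

theorem coeff_lpkPoly (n k : ℕ) :
    (lpkPoly n).coeff k = ∑ π : Equiv.Perm (Fin n), if k = lpk π then 1 else 0 := by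
  simp [lpkPoly, coeff_X_pow]

theorem coeff_lpkPoly_nonneg (n k : ℕ) : 0 ≤ (lpkPoly n).coeff k := by
  rw [coeff_lpkPoly]
  exact Finset.sum_nonneg fun π _ => by split_ifs <;> simp

theorem coeff_lpkPoly_succ (n k : ℕ) :
    (lpkPoly (n + 1)).coeff (k + 1) = (2 * k + 3) * (lpkPoly n).coeff (k + 1) +
      ((n : ℤ) - 2 * k) * (lpkPoly n).coeff k := by
  rw [lpkPoly_succ, show (1 + (n : ℤ[X]) * X) * lpkPoly n +
      2 * X * (1 - X) * derivative (lpkPoly n) = lpkPoly n + C (n : ℤ) * (X * lpkPoly n) +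
      C 2 * (X * derivative (lpkPoly n)) - C 2 * (X * (X * derivative (lpkPoly n))) by
    simp only [map_natCast, map_ofNat]; ring]
  simp only [coeff_add, coeff_sub, coeff_C_mul, coeff_X_mul, coeff_derivative]
  cases k with
  | zero => simp; ring
  | succ k => simp only [coeff_X_mul, coeff_derivative]; push_cast; ring

theorem coeff_lpkPoly_pos {n k : ℕ} (h : 2 * k ≤ n) : 0 < (lpkPoly n).coeff k := by
  induction n generalizing k with
  | zero =>
    obtain rfl : k = 0 := by omega
    simp [lpkPoly_zero]
  | succ n ih =>
    cases k with
    | zero =>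
      have : (lpkPoly (n + 1)).coeff 0 = (lpkPoly n).coeff 0 := by
        simp [lpkPoly_succ, mul_assoc, mul_coeff_zero]
      rw [this]
      exact ih (Nat.zero_le _)
    | succ k =>
      rw [coeff_lpkPoly_succ]
      have h1 := mul_nonneg (by positivity : (0 : ℤ) ≤ 2 * k + 3) (coeff_lpkPoly_nonneg n (k + 1))
      have h2 := mul_pos (by omega : (0 : ℤ) < (n : ℤ) - 2 * k) (ih (by omega : 2 * k ≤ n))
      omega

theorem exists_lpk_eq {n k : ℕ} (h : 2 * k ≤ n) : ∃ π : Equiv.Perm (Fin n), lpk π = k := by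
  by_contra hne
  push Not at hne
  have := coeff_lpkPoly_pos h
  rw [coeff_lpkPoly, Finset.sum_eq_zero fun π _ => if_neg (hne π).symm] at this
  exact lt_irrefl _ this

/-! ### The polynomials `ξ_n` -/

theorem xi_eq_zero (n : ℕ) (i : ℤ) (h : i < 0 ∨ (n : ℤ) < 2 * i) : xi n i = 0 := by
  induction n generalizing i with
  | zero =>
    rw [xi, if_neg]
    rintro rfl
    simp at h
  | succ n ih =>
    rw [xi]
    push_cast at h
    have h0 : xi n i = 0 := ih i (by omega)
    have h1 : ((n : ℤ) - 2 * i + 2) * xi n (i - 1) = 0 := by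
      by_cases hi : (n : ℤ) - 2 * i + 2 = 0
      · rw [hi, zero_mul]
      · rw [ih (i - 1) (by omega), mul_zero]
    have h2 : 4 * (i + 1) * xi n (i + 1) = 0 := by
      by_cases hi : i + 1 = 0
      · rw [hi]; ring
      · rw [ih (i + 1) (by omega), mul_zero]
    rw [h0, h1, h2]
    ring

theorem coeff_xiPoly (n i : ℕ) : (xiPoly n).coeff i = xi n i := by
  simp only [xiPoly, finsetSum_coeff, coeff_C_mul_X_pow, Finset.sum_ite_eq, Finset.mem_range]
  split_ifs with h
  · rfl
  · exact (xi_eq_zero n i (by omega)).symm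

theorem xiPoly_zero : xiPoly 0 = 1 := by
  simp [xiPoly, xi]

theorem xiPoly_succ (n : ℕ) :
    xiPoly (n + 1) = (1 + 2 * (n : ℤ[X]) + (n : ℤ[X]) * X) * xiPoly n -
      2 * (X + 1) * (X + 2) * derivative (xiPoly n) := by
  rw [show (1 + 2 * (n : ℤ[X]) + (n : ℤ[X]) * X) * xiPoly n -
      2 * (X + 1) * (X + 2) * derivative (xiPoly n) =
      C (1 + 2 * (n : ℤ)) * xiPoly n + C (n : ℤ) * (X * xiPoly n) -
      C (2 : ℤ) * (X * (X * derivative (xiPoly n))) - C (6 : ℤ) * (X * derivative (xiPoly n)) -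
      C (4 : ℤ) * derivative (xiPoly n) by
    simp only [map_add, map_mul, map_one, map_natCast, map_ofNat]; ring]
  ext i
  simp only [coeff_add, coeff_sub, coeff_C_mul, coeff_derivative, coeff_xiPoly]
  rw [xi]
  match i with
  | 0 =>
    rw [xi_eq_zero n _ (by simp : ((0 : ℕ) : ℤ) - 1 < 0 ∨ _)]
    simp
  | 1 =>
    simp [coeff_X_mul, coeff_derivative, coeff_xiPoly]
    ring
  | i + 2 =>
    simp only [coeff_X_mul, coeff_derivative, coeff_xiPoly]
    push_cast
    rw [show (i : ℤ) + 2 - 1 = i + 1 by ring, show (i : ℤ) + 1 + 1 = i + 2 by ring]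
    ring

theorem xiPoly_eq_comp (n : ℕ) : xiPoly n = (lpkPoly n).comp (X + 2) := by
  induction n with
  | zero => simp [xiPoly_zero, lpkPoly_zero]
  | succ n ih =>
    have hd : derivative (xiPoly n) = (derivative (lpkPoly n)).comp (X + 2) := by
      rw [ih, derivative_comp]
      simp
    rw [xiPoly_succ, lpkPoly_succ, hd, ih]
    simp only [add_comp, mul_comp, sub_comp, one_comp, natCast_comp, X_comp, ofNat_comp]
    simp only [Nat.cast_ofNat]
    ring

theorem xi_eq_sum_choose (n i : ℕ) :
    xi n i = ∑ π : Equiv.Perm (Fin n), 2 ^ (lpk π - i) * ((lpk π).choose i : ℤ) := by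
  rw [← coeff_xiPoly, xiPoly_eq_comp, lpkPoly, Polynomial.sum_comp, finsetSum_coeff]
  refine Finset.sum_congr rfl fun π _ => ?_
  rw [X_pow_comp, show (X + 2 : ℤ[X]) = X + C 2 by simp, coeff_X_add_C_pow]

theorem xi_pos {n i : ℕ} (h : i ≤ n / 2) : 0 < xi n i := by
  rw [xi_eq_sum_choose]
  obtain ⟨π, hπ⟩ := exists_lpk_eq (n := n) (k := i) (by omega)
  refine Finset.sum_pos' (fun π _ => by positivity) ⟨π, Finset.mem_univ _, ?_⟩
  simp [hπ]

theorem xiPoly_comp_X_sub_two (n : ℕ) :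
    (xiPoly n).comp (X - 2) = ∑ π : Equiv.Perm (Fin n), X ^ lpk π := by
  rw [xiPoly_eq_comp, comp_assoc, show (X + 2 : ℤ[X]).comp (X - 2) = X by simp, comp_X, lpkPoly]

theorem xiPoly_comp_X_sub_one (n : ℕ) :
    (xiPoly n).comp (X - 1) = ∑ π : Equiv.Perm (Fin n), (X + 1) ^ lpk π := by
  rw [xiPoly_eq_comp, comp_assoc, show (X + 2 : ℤ[X]).comp (X - 1) = X + 1 by simp; ring,
    lpkPoly, Polynomial.sum_comp]
  simp

/-! ### Expansion of the alternating Eulerian polynomial -/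

/-- Homogenised binomial theorem: `(u + 2 v²)^k v^(n - 2k)` expanded in `u^i v^(n - 2i)`. -/
theorem pow_mul_add_two_mul_sq_pow {R : Type*} [CommRing R] (u v : R) {n k : ℕ}
    (h : 2 * k ≤ n) :
    v ^ (n - 2 * k) * (u + 2 * v ^ 2) ^ k =
      ∑ i ∈ Finset.range (n / 2 + 1),
        ((2 ^ (k - i) * (k.choose i : ℤ) : ℤ) : R) * u ^ i * v ^ (n - 2 * i) := by
  rw [add_pow, Finset.mul_sum]
  rw [← Finset.sum_subset (Finset.range_mono (by omega : k + 1 ≤ n / 2 + 1))]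
  · refine Finset.sum_congr rfl fun i hi => ?_
    have hi : i ≤ k := by simpa [Nat.lt_succ_iff] using hi
    rw [show n - 2 * i = n - 2 * k + 2 * (k - i) by omega, pow_add, pow_mul]
    push_cast
    ring
  · intro i _ hi
    rw [Nat.choose_eq_zero_of_lt (by simpa using hi)]
    simp

theorem altEulerianB_eq_sum_xi (n : ℕ) :
    altEulerianB n =
      ∑ i ∈ Finset.range (n / 2 + 1), C (xi n i) * (-4 * X) ^ i * (1 + X) ^ (n - 2 * i) := by
  -- `2 (1 + X²) = -4 X + 2 (1 + X)²`
  have key : ∀ π : Equiv.Perm (Fin n), (1 + X : ℤ[X]) ^ (n - 2 * lpk π) *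
      (2 * (1 + X ^ 2)) ^ lpk π = ∑ i ∈ Finset.range (n / 2 + 1),
        C (2 ^ (lpk π - i) * ((lpk π).choose i : ℤ)) * (-4 * X) ^ i * (1 + X) ^ (n - 2 * i) := by
    intro π
    rw [show (2 * (1 + X ^ 2) : ℤ[X]) = -4 * X + 2 * (1 + X) ^ 2 by ring,
      pow_mul_add_two_mul_sq_pow _ _ (two_mul_lpk_le π)]
    rfl
  rw [altEulerianB_eq_sum_perm, Finset.sum_congr rfl fun π _ => key π, Finset.sum_comm]
  refine Finset.sum_congr rfl fun i _ => ?_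
  rw [← Finset.sum_mul, ← Finset.sum_mul, ← map_sum, ← xi_eq_sum_choose]

/-! ### Uniqueness of the `γ`-vector -/

theorem gamma_eq_zero_of_sum_eq_zero {n : ℕ} {d : ℕ → ℤ}
    (h : ∑ k ∈ Finset.range (n / 2 + 1), C (d k) * X ^ k * (1 + X) ^ (n - 2 * k) = (0 : ℤ[X]))
    {i : ℕ} (hi : i ≤ n / 2) : d i = 0 := by
  induction i using Nat.strong_induction_on with
  | _ i ih =>
    -- the coefficient of `X ^ i` only sees the terms with `k ≤ i`
    have hc := congrArg (fun f => coeff f i) h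
    simp only [finsetSum_coeff, coeff_zero] at hc
    rw [Finset.sum_eq_single_of_mem i (by simp; omega)] at hc
    · rw [mul_assoc, coeff_C_mul, coeff_X_pow_mul', if_pos le_rfl, Nat.sub_self,
        coeff_zero_eq_eval_zero] at hc
      simpa using hc
    · intro k _ hk
      rcases lt_or_gt_of_ne hk with hlt | hgt
      · simp [ih k hlt (by omega)]
      · rw [mul_assoc, coeff_C_mul, coeff_X_pow_mul', if_neg (by omega), mul_zero]

theorem isGammaVector_altEulerianB (n : ℕ) :
    IsGammaVector n (altEulerianB n) fun i => (-4) ^ i * xi n i := by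
  rw [IsGammaVector, altEulerianB_eq_sum_xi]
  refine Finset.sum_congr rfl fun i _ => ?_
  simp only [map_mul, map_pow, map_neg, map_ofNat, mul_pow]
  ring

theorem isGammaVector_altEulerianB_iff (n : ℕ) (γ : ℕ → ℤ) :
    IsGammaVector n (altEulerianB n) γ ↔ ∀ i : ℕ, i ≤ n / 2 → γ i = (-4) ^ i * xi n i := by
  have h0 := isGammaVector_altEulerianB n
  constructor
  · intro h i hi
    unfold IsGammaVector at h h0
    refine sub_eq_zero.1 (gamma_eq_zero_of_sum_eq_zero (n := n)
      (d := fun i => γ i - (-4) ^ i * xi n i) ?_ hi)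
    rw [← sub_eq_zero.2 (h.symm.trans h0), ← Finset.sum_sub_distrib]
    refine Finset.sum_congr rfl fun k _ => ?_
    rw [map_sub]
    ring
  · intro h
    unfold IsGammaVector at h0 ⊢
    rw [h0]
    refine Finset.sum_congr rfl fun k hk => ?_
    rw [h k (by simpa [Nat.lt_succ_iff] using hk)]

/-! ### The secant derivative polynomials -/

/-- Both sides satisfy the same recurrence; the one for the right-hand side comes from
differentiating in `y`. -/
theorem aeval_secDerivPoly (n : ℕ) {y : ℝ} (hy : y ≠ 0) :
    aeval y (secDerivPoly n) = y ^ n * aeval ((y ^ 2)⁻¹ - 1) (xiPoly n) := by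
  induction n generalizing y with
  | zero => simp [secDerivPoly, xiPoly_zero]
  | succ n ih =>
    have hev : (fun t : ℝ => aeval t (secDerivPoly n)) =ᶠ[nhds y]
        fun t => t ^ n * aeval ((t ^ 2)⁻¹ - 1) (xiPoly n) := by
      filter_upwards [continuousAt_id.eventually_ne hy] with t ht
      exact ih ht
    have hin : HasDerivAt (fun t : ℝ => (t ^ 2)⁻¹ - 1) (-2 / y ^ 3) y := by
      have := ((hasDerivAt_pow 2 y).fun_inv (pow_ne_zero 2 hy)).sub_const 1
      refine this.congr_deriv ?_
      field_simp
      norm_num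
      ring
    have hR := (hasDerivAt_pow n y).mul
      (((xiPoly n).hasDerivAt_aeval ((y ^ 2)⁻¹ - 1)).comp y hin)
    have hd := ((secDerivPoly n).hasDerivAt_aeval y).unique (hR.congr_of_eventuallyEq hev)
    have hpow : (n : ℝ) * y ^ (n - 1) = n * y ^ n / y := by
      cases n with
      | zero => simp
      | succ m => rw [Nat.add_sub_cancel, pow_succ]; field_simp
    rw [hpow] at hd
    rw [secDerivPoly, xiPoly_succ]
    simp only [map_add, map_mul, map_sub, map_pow, map_one, aeval_X, map_natCast, map_ofNat]
    rw [hd, ih hy]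
    simp only [Function.comp_apply]
    field_simp
    ring

theorem aeval_xiPoly_sub_one (n : ℕ) {x : ℝ} (hx : 0 < x) :
    aeval (x - 1) (xiPoly n) =
      x ^ ((n : ℝ) / 2) * aeval (1 / Real.sqrt x) (secDerivPoly n) := by
  have hs : 0 < Real.sqrt x := Real.sqrt_pos.2 hx
  have hp : x ^ ((n : ℝ) / 2) = Real.sqrt x ^ n := by
    rw [Real.sqrt_eq_rpow, ← Real.rpow_natCast, ← Real.rpow_mul hx.le]
    ring_nf
  rw [aeval_secDerivPoly n (one_div_ne_zero hs.ne'), hp, ← mul_assoc, ← mul_pow,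
    mul_one_div_cancel hs.ne', one_pow, one_mul, one_div, inv_pow, inv_inv, Real.sq_sqrt hx.le]

/-! ### Conclusion -/

theorem mainTheorem3 :
    -- the recurrence and initial conditions of the numbers `ξ_{n,i}`
    ((∀ i : ℤ, xi 0 i = if i = 0 then 1 else 0) ∧
      (∀ (n : ℕ) (i : ℤ), xi (n + 1) i =
        (1 + 2 * (n : ℤ) - 6 * i) * xi n i + ((n : ℤ) - 2 * i + 2) * xi n (i - 1)
          - 4 * (i + 1) * xi n (i + 1)) ∧
      (∀ (n : ℕ) (i : ℤ), (i < 0 ∨ (n : ℤ) < 2 * i) → xi n i = 0)) ∧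
    ∀ n : ℕ,
      -- the expansion of the type `B` alternating Eulerian polynomial
      altEulerianB n =
        ∑ i ∈ Finset.range (n / 2 + 1), C (xi n i) * (-4 * X) ^ i * (1 + X) ^ (n - 2 * i) ∧
      -- `ξ_n(x-1) = x^{n/2} Q_n(1/√x) = ∑_π (x+1)^{lpk π}`
      (∀ x : ℝ, 0 < x →
        aeval (x - 1) (xiPoly n)
          = x ^ ((n : ℝ) / 2) * aeval (1 / Real.sqrt x) (secDerivPoly n)) ∧
      (xiPoly n).comp (X - 1) = ∑ π : Equiv.Perm (Fin n), (X + 1) ^ lpk π ∧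
      -- `ξ_n(x-2) = ∑_π x^{lpk π}`
      (xiPoly n).comp (X - 2) = ∑ π : Equiv.Perm (Fin n), X ^ lpk π ∧
      -- positivity
      (∀ i : ℕ, i ≤ n / 2 → 0 < xi n i) ∧
      -- the `γ`-vector is uniquely determined and alternates in sign
      (∀ γ : ℕ → ℤ, IsGammaVector n (altEulerianB n) γ ↔
        ∀ i : ℕ, i ≤ n / 2 → γ i = (-4) ^ i * xi n i) ∧
      (∀ γ : ℕ → ℤ, IsGammaVector n (altEulerianB n) γ →
        ∀ i : ℕ, i ≤ n / 2 → 0 < (-1) ^ i * γ i) := by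
  refine ⟨⟨fun i => rfl, fun n i => rfl, xi_eq_zero⟩, fun n => ⟨altEulerianB_eq_sum_xi n,
    fun x hx => aeval_xiPoly_sub_one n hx, xiPoly_comp_X_sub_one n, xiPoly_comp_X_sub_two n,
    fun i hi => xi_pos hi, isGammaVector_altEulerianB_iff n, fun γ hγ i hi => ?_⟩⟩
  rw [(isGammaVector_altEulerianB_iff n γ).1 hγ i hi, ← mul_assoc, ← mul_pow]
  exact mul_pos (by norm_num) (xi_pos hi)
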